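/- **Model.** Let $\lambda,\mu_1,\mu_2,\beta>0$ with $\mu_1<\mu_2$ and $\lambda+\mu_1+\mu_2+\beta=1$, let $\mu\in\{\mu_1,\mu_2\}$ with $\mu>\lambda$, and let $c_{\mu_1}=0<c_{\mu_2}$. Let $h:\mathbb N_0\to[0,\infty)$ be non-decreasing, convex and unbounded, with $h(0)=0$ and $\sum_{i\ge 0}h(i)x^i<\infty$ for all $0<x<1$. The state space is $S=\mathbb N_0\times\{0,1\}$, where $i$ is the number of customers and $q=1$ (resp. $q=0$) means that there is (resp. is not) service rate control. A policy $\phi\in\Phi$ (stationary, deterministic) selects a rate $\phi(i,1)\in\{\mu_1,\mu_2\}$ in each state $(i,1)$, and $\phi(i,0)=\mu$. Under $\phi$, the state evolves as a discrete time Markov chain $(Y_n)_{n\ge0}$ which moves * from $(i,1)$, with $a=\phi(i,1)$: to $(i+1,1)$ with probability $\lambda$, to $(i,0)$ with probability $\beta$, to $(i-1,1)$ with probability $a\mathbf 1_{\{i>0\}}$, and otherwise stays in $(i,1)$; * from $(i,0)$: to $(i+1,0)$ with probability $\lambda$, to $(i-1,0)$ with probability $\mu\mathbf 1_{\{i>0\}}$,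 and otherwise stays in $(i,0)$. The one-step cost is $c^\phi(i,q)=c_{\phi(i,q)}+h(i)$, and for $0<\alpha<1$ the expected total $\alpha$-discounted cost is $$V^\phi_\alpha(i,q)=\mathbb E^\phi_{(i,q)}\Big[\sum_{n=0}^\infty(1-\alpha)^n c^\phi(Y_n)\Big].$$ **Value iteration (non-discounted).** Put $V_0\equiv0$ and, for $n\ge0$, writing $i^+=\max\{i,0\}$, $$V_{n+1}(i,1)=h(i)+\mu_1V_n(i,1)+\mu_1V_n((i-1)^+,1)+\lambda V_n(i+1,1)+\beta V_n(i,0)+\min_{a\in\{\mu_1,\mu_2\}}\big\{c_a+(a-\mu_1)V_n((i-1)^+,1)+(\mu_2-a)V_n(i,1)\big\},$$ $$V_{n+1}(i,0)=c_\mu+h(i)+\mu V_n((i-1)^+,0)+(1-\mu-\lambda)V_n(i,0)+\lambda V_n(i+1,0).$$ Let $\phi_{n+1}\in\Phi$ be a policy such that, for every $i$, $\phi_{n+1}(i,1)$ attains the minimum in the formula for $V_{n+1}(i,1)$ (ties may be broken arbitrarily, in particular in favour of $\mu_1$). A *limiting policy of value iteration* is any $\phi^\ast\in\Phi$ that is a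 limit point, with respect to pointwise convergence on $S$, of such a sequence $(\phi_n)_{n\ge1}$. **Proposition.** Every limiting policy $\phi^\ast$ of value iteration is strongly Blackwell optimal: there is $\alpha'>0$ such that $V^{\phi^\ast}_\alpha(i,q)\le V^\phi_\alpha(i,q)$ for all $0<\alpha<\alpha'$, all $\phi\in\Phi$ and all $(i,q)\in S$. -/

import Mathlib

open MeasureTheory ProbabilityTheory Filter Topology
open scoped ENNReal

/-- Parameters of the (uniformised, discrete time) M/M/1 queue with a single exponentially
distributed period of service rate control, with the standing assumptions on them. -/
structure ControlledQueue where
  /-- arrival rate -/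
  lam : ℝ
  /-- low service rate -/
  mu1 : ℝ
  /-- high service rate -/
  mu2 : ℝ
  /-- rate at which control is lost -/
  beta : ℝ
  /-- fixed service rate once control is lost -/
  mu : ℝ
  /-- cost per time unit of the high service rate; the low rate is free -/
  c2 : ℝ
  /-- holding cost, as a function of the number of customers -/
  h : ℕ → ℝ
  lam_pos : 0 < lam
  mu1_pos : 0 < mu1
  mu1_lt_mu2 : mu1 < mu2
  beta_pos : 0 < beta
  mu_mem : mu = mu1 ∨ mu = mu2
  lam_lt_mu : lam < mu
  rates_sum : lam + mu1 + mu2 + beta = 1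
  c2_pos : 0 < c2
  h_zero : h 0 = 0
  h_nonneg : ∀ i, 0 ≤ h i
  h_mono : Monotone h
  h_convex : ∀ i, h (i + 1) - h i ≤ h (i + 2) - h (i + 1)
  h_unbounded : ¬ BddAbove (Set.range h)
  h_summable : ∀ x : ℝ, 0 < x → x < 1 → Summable (fun i : ℕ => h i * x ^ i)

namespace ControlledQueue

/-- States `(i, q)`: `i` customers, with control (`q = 1`) or without control (`q = 0`). -/
abbrev State : Type := ℕ × Fin 2

variable (Q : ControlledQueue)

/-- Available actions (service rates). -/
def actions (s : State) : Set ℝ :=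
  if s.2 = 1 then {Q.mu1, Q.mu2} else {Q.mu}

/-- Stationary deterministic policies, with the topology of pointwise convergence on states. -/
abbrev Policy : Type := {φ : State → ℝ // ∀ s, φ s ∈ Q.actions s}

/-- Cost per time unit of using service rate `a`. -/
noncomputable def rateCost (a : ℝ) : ℝ := if a = Q.mu2 then Q.c2 else 0

/-- One-step cost `c^φ`. -/
noncomputable def cost (φ : Q.Policy) (s : State) : ℝ := Q.rateCost (φ.1 s) + Q.h s.1

/-- Service rate `a` if a customer is present, `0` in an empty system. -/
noncomputable def departure (a : ℝ) (i : ℕ) : ℝ := if 0 < i then a else 0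

/-- One-step transition law out of the state `s` when the service rate `a` is used. -/
noncomputable def stepLaw (a : ℝ) (s : State) : Measure State :=
  if s.2 = 1 then
    ENNReal.ofReal Q.lam • Measure.dirac (s.1 + 1, 1)
      + ENNReal.ofReal Q.beta • Measure.dirac (s.1, 0)
      + ENNReal.ofReal (departure a s.1) • Measure.dirac (s.1 - 1, 1)
      + ENNReal.ofReal (1 - Q.lam - Q.beta - departure a s.1) • Measure.dirac (s.1, 1)
  else
    ENNReal.ofReal Q.lam • Measure.dirac (s.1 + 1, 0)
      + ENNReal.ofReal (departure a s.1) • Measure.dirac (s.1 - 1, 0)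
      + ENNReal.ofReal (1 - Q.lam - departure a s.1) • Measure.dirac (s.1, 0)

/-- Transition kernel `P^φ` of the Markov chain under the policy `φ`. -/
noncomputable def kernel (φ : Q.Policy) : Kernel State State :=
  Kernel.ofFunOfCountable (fun s => Q.stepLaw (φ.1 s) s)

theorem stepLaw_isProbabilityMeasure (s : State) (a : ℝ) (ha : a ∈ Q.actions s) :
    IsProbabilityMeasure (Q.stepLaw a s) := by
  have h1 := Q.lam_pos
  have h2 := Q.mu1_pos
  have h3 := Q.mu1_lt_mu2
  have h4 := Q.beta_pos
  have h5 := Q.rates_sum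
  constructor
  by_cases hs : s.2 = 1
  · have hd : 0 ≤ departure a s.1 ∧ departure a s.1 ≤ Q.mu2 := by
      have ha' : a = Q.mu1 ∨ a = Q.mu2 := by simpa [actions, hs] using ha
      unfold departure
      split_ifs <;> rcases ha' with rfl | rfl <;> constructor <;> linarith
    simp only [stepLaw, hs, if_true, Measure.add_apply, Measure.smul_apply, measure_univ,
      smul_eq_mul, mul_one]
    rw [← ENNReal.ofReal_add (by linarith) (by linarith),
      ← ENNReal.ofReal_add (by linarith) (by linarith [hd.1]),
      ← ENNReal.ofReal_add (by linarith [hd.1]) (by linarith [hd.2]),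
      ← ENNReal.ofReal_one]
    congr 1
    ring
  · have hd : 0 ≤ departure a s.1 ∧ departure a s.1 ≤ Q.mu2 := by
      have ha' : a = Q.mu := by simpa [actions, hs] using ha
      have ha'' : a = Q.mu1 ∨ a = Q.mu2 := by rw [ha']; exact Q.mu_mem
      unfold departure
      split_ifs <;> rcases ha'' with h | h <;> constructor <;> linarith
    simp only [stepLaw, hs, if_false, Measure.add_apply, Measure.smul_apply, measure_univ,
      smul_eq_mul, mul_one]
    rw [← ENNReal.ofReal_add (by linarith) (by linarith [hd.1]),
      ← ENNReal.ofReal_add (by linarith [hd.1]) (by linarith [hd.2]),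
      ← ENNReal.ofReal_one]
    congr 1
    ring

instance instIsMarkovKernelKernel (φ : Q.Policy) : IsMarkovKernel (Q.kernel φ) :=
  ⟨fun s => Q.stepLaw_isProbabilityMeasure s (φ.1 s) (φ.2 s)⟩

/-- The kernel `P^φ` as a kernel from histories up to time `n` to the state at time `n + 1`: it
only looks at the state at time `n`. -/
noncomputable def historyKernel (φ : Q.Policy) (n : ℕ) :
    Kernel ((k : Finset.Iic n) → State) State :=
  (Q.kernel φ).comap (fun ω => ω ⟨n, Finset.mem_Iic.mpr le_rfl⟩) (measurable_pi_apply _)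

instance instIsMarkovKernelHistoryKernel (φ : Q.Policy) (n : ℕ) :
    IsMarkovKernel (Q.historyKernel φ n) := by
  unfold historyKernel
  infer_instance

/-- Law of the trajectory `(Y_0, Y_1, …)` of the Markov chain with transition kernel `P^φ` and
`Y_0 = s`. -/
noncomputable def pathLaw (φ : Q.Policy) (s : State) : Measure (ℕ → State) :=
  Kernel.traj (X := fun _ : ℕ => State) (Q.historyKernel φ) 0 (fun _ => s)

/-- Expected total `α`-discounted cost `V_α^φ(s) = E_s^φ [∑ₙ (1 - α)ⁿ c^φ(Yₙ)]` (for
`0 < α < 1`). The costs are nonnegative, so this is defined as an element of `[0, ∞]`. -/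
noncomputable def discountedCost (φ : Q.Policy) (α : ℝ) (s : State) : ℝ≥0∞ :=
  ∫⁻ ω, ∑' n : ℕ, ENNReal.ofReal ((1 - α) ^ n * Q.cost φ (ω n)) ∂(Q.pathLaw φ s)

/-- The expression that value iteration minimises over the service rates `a ∈ {μ₁, μ₂}` in the
state `(i, 1)`. Natural subtraction `i - 1` is `(i - 1)⁺`. -/
noncomputable def actionCost (α : ℝ) (V : State → ℝ) (i : ℕ) (a : ℝ) : ℝ :=
  Q.rateCost a + (1 - α) * ((a - Q.mu1) * V (i - 1, 1) + (Q.mu2 - a) * V (i, 1))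

/-- The value iterates `V_{α,n}`. -/
noncomputable def valueIter (α : ℝ) : ℕ → State → ℝ
  | 0 => fun _ => 0
  | n + 1 => fun s =>
    let V := valueIter α n
    if s.2 = 1 then
      Q.h s.1
        + (1 - α) * (Q.mu1 * V (s.1, 1) + Q.mu1 * V (s.1 - 1, 1) + Q.lam * V (s.1 + 1, 1)
          + Q.beta * V (s.1, 0))
        + min (Q.actionCost α V s.1 Q.mu1) (Q.actionCost α V s.1 Q.mu2)
    else
      Q.rateCost Q.mu + Q.h s.1
        + (1 - α) * (Q.mu * V (s.1 - 1, 0) + (1 - Q.mu - Q.lam) * V (s.1, 0)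
          + Q.lam * V (s.1 + 1, 0))

/-- `φ 1, φ 2, …` are policies produced by value iteration: `φ (n + 1)` picks in each state
`(i, 1)` a minimiser for `V_{α,n}`. Ties may be broken in any way; `φ 0` is irrelevant. -/
def IsVIPolicySeq (α : ℝ) (φ : ℕ → Q.Policy) : Prop :=
  ∀ n i, ∀ a ∈ Q.actions (i, 1),
    Q.actionCost α (Q.valueIter α n) i ((φ (n + 1)).1 (i, 1))
      ≤ Q.actionCost α (Q.valueIter α n) i a

/-- `φ'` is a limiting policy of (non-discounted) value iteration: a limit point of a sequence of
policies produced by value iteration with `α = 0`. -/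
def IsLimitingPolicy (φ' : Q.Policy) : Prop :=
  ∃ φ : ℕ → Q.Policy, Q.IsVIPolicySeq 0 φ ∧ MapClusterPt φ' atTop φ

/-- Strong Blackwell optimality. -/
def StronglyBlackwellOptimal (φ' : Q.Policy) : Prop :=
  ∃ α' : ℝ, 0 < α' ∧ ∀ α : ℝ, 0 < α → α < α' → ∀ φ : Q.Policy, ∀ s : State,
    Q.discountedCost φ' α s ≤ Q.discountedCost φ α s

end ControlledQueue

namespace ControlledQueue

variable (Q : ControlledQueue)

/-! ### Discounted costs as iterates of the transition operator -/

/-! Costs are nonnegative, so a discounted cost is the supremum of its finite-horizon truncations,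
and no finiteness or convergence of value iteration is needed. Value iterates lie below the cost of
every policy (`ofReal_valueIter_le_discountedCost`). A policy that is greedy for all late iterates
has its truncations below value iterates, hence is optimal (`discountedCost_le_of_isGreedy`).

It remains to make the limiting policy eventually greedy for every small discount. Greedy choices
compare a multiple of the increment in the number of customers with `c2`. The increments obey a
recursion that is monotone in all its arguments, so they are nonnegative, grow with the iteration
and with the number of customers, and shrink under discounting. Under control they also keep growing
strictly, which removes ties: the limiting policy uses the high rate exactly where some undiscounted
increment strictly exceeds the threshold (`IsLimitingPolicy.apply_eq_mu2_iff`).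

At low-rate states discounting only lowers the increments, so the low rate remains greedy. At
high-rate states it is enough to treat the smallest one at one iteration, by continuity in the
discount; monotonicity extends this to all larger states and later iterations. Hence one bound on
the discount serves all states. -/

/-- Transition operator of the chain under the policy `φ`, on nonnegative functions. -/
noncomputable def transOp (φ : Q.Policy) (f : State → ℝ≥0∞) (s : State) : ℝ≥0∞ :=
  ∫⁻ t, f t ∂(Q.kernel φ s)

/-- The Markov property: given the history up to time `n`, the next coordinate has the one-step law
from the current state. -/
theorem lintegral_pathLaw (φ : Q.Policy) (s : State) (n : ℕ) (f : State → ℝ≥0∞) :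
    ∫⁻ ω, f (ω n) ∂(Q.pathLaw φ s) = (Q.transOp φ)^[n] f s := by
  have hev : ∀ (k : ℕ) (g : State → ℝ≥0∞), Measurable (fun ω : ℕ → State => g (ω k)) :=
    fun k g => (measurable_of_countable g).comp (measurable_pi_apply k)
  induction n generalizing f with
  | zero =>
    have hmap := Kernel.traj_map_frestrictLe_apply (X := fun _ : ℕ => State)
      (κ := Q.historyKernel φ) 0 0 (fun _ => s)
    have hf : Measurable (fun x : (i : Finset.Iic 0) → State =>
        f (x ⟨0, Finset.mem_Iic.mpr le_rfl⟩)) :=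
      (measurable_of_countable f).comp (measurable_pi_apply _)
    have h := lintegral_map (μ := Q.pathLaw φ s) hf
      (Preorder.measurable_frestrictLe (X := fun _ : ℕ => State) 0)
    rw [pathLaw, hmap, Kernel.partialTraj_self, Kernel.id_apply, lintegral_dirac' _ hf] at h
    exact h.symm
  | succ n ih =>
    rw [Function.iterate_succ_apply, ← ih]
    have hP : Measurable (fun x : (i : Finset.Iic n) → State =>
        Q.transOp φ f (x ⟨n, Finset.mem_Iic.mpr le_rfl⟩)) :=
      (measurable_of_countable (Q.transOp φ f)).comp (measurable_pi_apply _)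
    have h := lintegral_map (μ := Q.pathLaw φ s) hP
      (Preorder.measurable_frestrictLe (X := fun _ : ℕ => State) n)
    rw [pathLaw, Kernel.traj_map_frestrictLe_apply] at h
    refine Eq.trans ?_ h
    rw [pathLaw, ← Kernel.traj_comp_partialTraj (Nat.zero_le n), Kernel.lintegral_comp _ _ _ (hev _ f)]
    refine lintegral_congr fun x => ?_
    have hx := Kernel.map_traj_succ_self (X := fun _ : ℕ => State) (κ := Q.historyKernel φ) (a := n)
    have hm : Measurable (fun ω : ℕ → State => ω (n + 1)) := measurable_pi_apply _
    rw [← lintegral_map (measurable_of_countable f) hm, ← Kernel.map_apply _ hm, hx]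
    rfl

theorem discountedCost_eq_tsum (φ : Q.Policy) {α : ℝ} (hα : α ≤ 1) (s : State) :
    Q.discountedCost φ α s = ∑' n : ℕ, ENNReal.ofReal (1 - α) ^ n *
      (Q.transOp φ)^[n] (fun t => ENNReal.ofReal (Q.cost φ t)) s := by
  have hm : ∀ n, Measurable (fun ω : ℕ → State => ENNReal.ofReal (Q.cost φ (ω n))) := fun n =>
    (measurable_of_countable (fun t => ENNReal.ofReal (Q.cost φ t))).comp (measurable_pi_apply n)
  have h1 : ∀ (n : ℕ) (x : ℝ), ENNReal.ofReal ((1 - α) ^ n * x)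
      = ENNReal.ofReal (1 - α) ^ n * ENNReal.ofReal x := fun n x => by
    rw [ENNReal.ofReal_mul (pow_nonneg (by linarith) _), ENNReal.ofReal_pow (by linarith)]
  simp only [discountedCost, h1]
  rw [lintegral_tsum fun n => ((hm n).const_mul _).aemeasurable]
  refine tsum_congr fun n => ?_
  rw [lintegral_const_mul _ (hm n), Q.lintegral_pathLaw φ s n fun t => ENNReal.ofReal (Q.cost φ t)]

/-- One step of policy evaluation. -/
noncomputable def evalOp (φ : Q.Policy) (α : ℝ) (f : State → ℝ≥0∞) (s : State) : ℝ≥0∞ :=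
  ENNReal.ofReal (Q.cost φ s) + ENNReal.ofReal (1 - α) * Q.transOp φ f s

theorem evalOp_mono (φ : Q.Policy) (α : ℝ) : Monotone (Q.evalOp φ α) := fun f g hfg s => by
  unfold evalOp transOp
  gcongr
  exact hfg _

theorem evalOp_iterate (φ : Q.Policy) (α : ℝ) (n : ℕ) (s : State) :
    (Q.evalOp φ α)^[n] 0 s = ∑ k ∈ Finset.range n, ENNReal.ofReal (1 - α) ^ k *
      (Q.transOp φ)^[k] (fun t => ENNReal.ofReal (Q.cost φ t)) s := by
  induction n generalizing s with
  | zero => simp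
  | succ n ih =>
    rw [Function.iterate_succ_apply', evalOp, transOp, Finset.sum_range_succ']
    simp only [ih]
    rw [lintegral_finsetSum _ fun k _ => measurable_of_countable _, Finset.mul_sum, add_comm]
    congr 1
    · refine Finset.sum_congr rfl fun k _ => ?_
      rw [lintegral_const_mul _ (measurable_of_countable _), ← mul_assoc, ← pow_succ',
        Function.iterate_succ_apply']
      rfl
    · simp

/-- Iterates started at `0` are the partial sums of the cost series, whose terms are nonnegative. -/
theorem iSup_evalOp_iterate (φ : Q.Policy) {α : ℝ} (hα : α ≤ 1) (s : State) :
    Q.discountedCost φ α s = ⨆ n, (Q.evalOp φ α)^[n] 0 s := by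
  simp only [Q.discountedCost_eq_tsum φ hα, ENNReal.tsum_eq_iSup_nat, evalOp_iterate]

/-! ### Value iteration and policy evaluation -/

theorem mu2_pos : 0 < Q.mu2 := Q.mu1_pos.trans Q.mu1_lt_mu2

theorem mu_pos : 0 < Q.mu := Q.lam_pos.trans Q.lam_lt_mu

theorem mu_add_lam_le : Q.mu + Q.lam ≤ 1 := by
  have h1 := Q.mu1_pos
  have h2 := Q.mu2_pos
  have h3 := Q.beta_pos
  have h4 := Q.rates_sum
  rcases Q.mu_mem with h | h <;> rw [h] <;> linarith

theorem rateCost_nonneg (a : ℝ) : 0 ≤ Q.rateCost a := by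
  unfold rateCost
  split_ifs
  exacts [Q.c2_pos.le, le_rfl]

theorem rateCost_mu1 : Q.rateCost Q.mu1 = 0 := if_neg Q.mu1_lt_mu2.ne

theorem rateCost_mu2 : Q.rateCost Q.mu2 = Q.c2 := if_pos rfl

theorem cost_nonneg (φ : Q.Policy) (s : State) : 0 ≤ Q.cost φ s :=
  add_nonneg (Q.rateCost_nonneg _) (Q.h_nonneg _)

theorem mem_actions_one {i : ℕ} {a : ℝ} : a ∈ Q.actions (i, 1) ↔ a = Q.mu1 ∨ a = Q.mu2 := by
  simp [actions]

theorem mem_actions_zero {i : ℕ} {a : ℝ} : a ∈ Q.actions (i, 0) ↔ a = Q.mu := by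
  simp [actions]

theorem valueIter_succ_one (α : ℝ) (n i : ℕ) :
    Q.valueIter α (n + 1) (i, 1) = Q.h i
        + (1 - α) * (Q.mu1 * Q.valueIter α n (i, 1) + Q.mu1 * Q.valueIter α n (i - 1, 1)
          + Q.lam * Q.valueIter α n (i + 1, 1) + Q.beta * Q.valueIter α n (i, 0))
        + min (Q.actionCost α (Q.valueIter α n) i Q.mu1)
          (Q.actionCost α (Q.valueIter α n) i Q.mu2) := by
  simp [valueIter]

theorem valueIter_succ_zero (α : ℝ) (n i : ℕ) :
    Q.valueIter α (n + 1) (i, 0) = Q.rateCost Q.mu + Q.h i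
        + (1 - α) * (Q.mu * Q.valueIter α n (i - 1, 0)
          + (1 - Q.mu - Q.lam) * Q.valueIter α n (i, 0)
          + Q.lam * Q.valueIter α n (i + 1, 0)) := by
  simp [valueIter]

theorem actionCost_nonneg {α : ℝ} (hα : α ≤ 1) {V : State → ℝ} (hV : ∀ s, 0 ≤ V s) (i : ℕ) {a : ℝ}
    (h1 : Q.mu1 ≤ a) (h2 : a ≤ Q.mu2) : 0 ≤ Q.actionCost α V i a := by
  have := Q.rateCost_nonneg a
  have := sub_nonneg.2 hα
  have := sub_nonneg.2 h1
  have := sub_nonneg.2 h2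
  have := hV (i - 1, 1)
  have := hV (i, 1)
  unfold actionCost
  positivity

theorem valueIter_nonneg {α : ℝ} (hα : α ≤ 1) (n : ℕ) (s : State) : 0 ≤ Q.valueIter α n s := by
  induction n generalizing s with
  | zero => exact le_rfl
  | succ n ih =>
    have h0 := sub_nonneg.2 hα
    have h1 := Q.mu1_pos
    have h2 := Q.lam_pos
    have h3 := Q.beta_pos
    have h4 := Q.mu_pos
    have h5 : 0 ≤ 1 - Q.mu - Q.lam := by linarith [Q.mu_add_lam_le]
    obtain ⟨i, q⟩ := s
    have hh := Q.h_nonneg i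
    fin_cases q
    · have := Q.rateCost_nonneg Q.mu
      have := ih (i - 1, 0)
      have := ih (i, 0)
      have := ih (i + 1, 0)
      change 0 ≤ Q.valueIter α (n + 1) (i, 0)
      rw [valueIter_succ_zero]
      positivity
    · have := le_min (Q.actionCost_nonneg hα ih i le_rfl Q.mu1_lt_mu2.le)
        (Q.actionCost_nonneg hα ih i Q.mu1_lt_mu2.le le_rfl)
      have := ih (i - 1, 1)
      have := ih (i, 1)
      have := ih (i + 1, 1)
      have := ih (i, 0)
      change 0 ≤ Q.valueIter α (n + 1) (i, 1)
      rw [valueIter_succ_one]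
      positivity

/-! ### Policy evaluation applied to value iterates -/

theorem lintegral_four_dirac {a b c d : ℝ} (ha : 0 ≤ a) (hb : 0 ≤ b) (hc : 0 ≤ c) (hd : 0 ≤ d)
    (w x y z : State) {V : State → ℝ} (hV : ∀ s, 0 ≤ V s) :
    ∫⁻ t, ENNReal.ofReal (V t) ∂(ENNReal.ofReal a • Measure.dirac w
      + ENNReal.ofReal b • Measure.dirac x + ENNReal.ofReal c • Measure.dirac y
      + ENNReal.ofReal d • Measure.dirac z : Measure State)
      = ENNReal.ofReal (a * V w + b * V x + c * V y + d * V z) := by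
  have hw := mul_nonneg ha (hV w)
  have hx := mul_nonneg hb (hV x)
  have hy := mul_nonneg hc (hV y)
  have hz := mul_nonneg hd (hV z)
  simp only [lintegral_add_measure, lintegral_smul_measure, lintegral_dirac, smul_eq_mul]
  rw [ENNReal.ofReal_add (by positivity) hz, ENNReal.ofReal_add (by positivity) hy,
    ENNReal.ofReal_add hw hx, ENNReal.ofReal_mul ha, ENNReal.ofReal_mul hb, ENNReal.ofReal_mul hc,
    ENNReal.ofReal_mul hd]

theorem lintegral_three_dirac {a b c : ℝ} (ha : 0 ≤ a) (hb : 0 ≤ b) (hc : 0 ≤ c)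
    (w x y : State) {V : State → ℝ} (hV : ∀ s, 0 ≤ V s) :
    ∫⁻ t, ENNReal.ofReal (V t) ∂(ENNReal.ofReal a • Measure.dirac w
      + ENNReal.ofReal b • Measure.dirac x + ENNReal.ofReal c • Measure.dirac y : Measure State)
      = ENNReal.ofReal (a * V w + b * V x + c * V y) := by
  simpa using lintegral_four_dirac ha hb hc le_rfl w x y y hV

theorem evalOp_ofReal_one (φ : Q.Policy) {α : ℝ} (hα : α ≤ 1) (n i : ℕ) :
    Q.evalOp φ α (fun t => ENNReal.ofReal (Q.valueIter α n t)) (i, 1) = ENNReal.ofReal (Q.h i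
        + (1 - α) * (Q.mu1 * Q.valueIter α n (i, 1) + Q.mu1 * Q.valueIter α n (i - 1, 1)
          + Q.lam * Q.valueIter α n (i + 1, 1) + Q.beta * Q.valueIter α n (i, 0))
        + Q.actionCost α (Q.valueIter α n) i (φ.1 (i, 1))) := by
  have h0 := sub_nonneg.2 hα
  have hV := Q.valueIter_nonneg hα n
  have h1 := Q.mu1_pos
  have h2 := Q.mu1_lt_mu2
  have h3 := Q.rates_sum
  have hdep : ∀ a ∈ Q.actions (i, 1), 0 ≤ departure a i ∧ departure a i ≤ Q.mu2 := by
    intro a ha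
    rw [mem_actions_one] at ha
    unfold departure
    split_ifs <;> rcases ha with rfl | rfl <;> constructor <;> linarith
  obtain ⟨hd0, hd2⟩ := hdep _ (φ.2 (i, 1))
  have key : Q.transOp φ (fun t => ENNReal.ofReal (Q.valueIter α n t)) (i, 1) = ENNReal.ofReal
      (Q.lam * Q.valueIter α n (i + 1, 1) + Q.beta * Q.valueIter α n (i, 0)
        + departure (φ.1 (i, 1)) i * Q.valueIter α n (i - 1, 1)
        + (1 - Q.lam - Q.beta - departure (φ.1 (i, 1)) i) * Q.valueIter α n (i, 1)) :=
    lintegral_four_dirac Q.lam_pos.le Q.beta_pos.le hd0 (by linarith) _ _ _ _ hV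
  have hnn : 0 ≤ Q.lam * Q.valueIter α n (i + 1, 1) + Q.beta * Q.valueIter α n (i, 0)
        + departure (φ.1 (i, 1)) i * Q.valueIter α n (i - 1, 1)
        + (1 - Q.lam - Q.beta - departure (φ.1 (i, 1)) i) * Q.valueIter α n (i, 1) := by
    have := mul_nonneg Q.lam_pos.le (hV (i + 1, 1))
    have := mul_nonneg Q.beta_pos.le (hV (i, 0))
    have := mul_nonneg hd0 (hV (i - 1, 1))
    have := mul_nonneg (show 0 ≤ 1 - Q.lam - Q.beta - departure (φ.1 (i, 1)) i by linarith)
      (hV (i, 1))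
    positivity
  rw [evalOp, key, ← ENNReal.ofReal_mul h0, ← ENNReal.ofReal_add (Q.cost_nonneg _ _) (by positivity)]
  congr 1
  -- Uniformisation: the rates sum to one, so the unused service rate goes into staying put. In the
  -- empty state the fictitious departure also stays put, since `0 - 1 = 0`.
  have hone : 1 = Q.lam + Q.mu1 + Q.mu2 + Q.beta := h3.symm
  rcases Nat.eq_zero_or_pos i with rfl | hi
  · simp only [cost, actionCost, departure, lt_irrefl, if_false, Nat.zero_sub]
    linear_combination (1 - α) * Q.valueIter α n (0, 1) * hone
  · simp only [cost, actionCost, departure, hi, if_true]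
    linear_combination (1 - α) * Q.valueIter α n (i, 1) * hone

theorem evalOp_ofReal_zero (φ : Q.Policy) {α : ℝ} (hα : α ≤ 1) (n i : ℕ) :
    Q.evalOp φ α (fun t => ENNReal.ofReal (Q.valueIter α n t)) (i, 0)
      = ENNReal.ofReal (Q.valueIter α (n + 1) (i, 0)) := by
  have h0 := sub_nonneg.2 hα
  have hV := Q.valueIter_nonneg hα n
  have h1 := Q.mu_pos
  have h2 := Q.mu_add_lam_le
  have hφ : φ.1 (i, 0) = Q.mu := Q.mem_actions_zero.1 (φ.2 (i, 0))
  have hd : 0 ≤ departure Q.mu i ∧ departure Q.mu i ≤ Q.mu := by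
    unfold departure
    split_ifs <;> constructor <;> linarith
  obtain ⟨hd0, hd2⟩ := hd
  have key : Q.transOp φ (fun t => ENNReal.ofReal (Q.valueIter α n t)) (i, 0) = ENNReal.ofReal
      (Q.lam * Q.valueIter α n (i + 1, 0) + departure Q.mu i * Q.valueIter α n (i - 1, 0)
        + (1 - Q.lam - departure Q.mu i) * Q.valueIter α n (i, 0)) := by
    rw [← lintegral_three_dirac Q.lam_pos.le hd0 (by linarith) _ _ _ hV, ← hφ]
    rfl
  have hnn : 0 ≤ Q.lam * Q.valueIter α n (i + 1, 0)
        + departure Q.mu i * Q.valueIter α n (i - 1, 0)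
        + (1 - Q.lam - departure Q.mu i) * Q.valueIter α n (i, 0) := by
    have := mul_nonneg Q.lam_pos.le (hV (i + 1, 0))
    have := mul_nonneg hd0 (hV (i - 1, 0))
    have := mul_nonneg (show 0 ≤ 1 - Q.lam - departure Q.mu i by linarith) (hV (i, 0))
    positivity
  rw [evalOp, key, ← ENNReal.ofReal_mul h0, ← ENNReal.ofReal_add (Q.cost_nonneg _ _) (by positivity),
    valueIter_succ_zero]
  congr 1
  rcases Nat.eq_zero_or_pos i with rfl | hi
  · simp only [cost, hφ, departure, lt_irrefl, if_false, Nat.zero_sub]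
    ring
  · simp only [cost, hφ, departure, hi, if_true]
    ring

theorem ofReal_valueIter_succ_le (φ : Q.Policy) {α : ℝ} (hα : α ≤ 1) (n : ℕ) (s : State) :
    ENNReal.ofReal (Q.valueIter α (n + 1) s)
      ≤ Q.evalOp φ α (fun t => ENNReal.ofReal (Q.valueIter α n t)) s := by
  obtain ⟨i, q⟩ := s
  fin_cases q
  · exact (Q.evalOp_ofReal_zero φ hα n i).ge
  · change ENNReal.ofReal (Q.valueIter α (n + 1) (i, 1))
      ≤ Q.evalOp φ α (fun t => ENNReal.ofReal (Q.valueIter α n t)) (i, 1)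
    rw [evalOp_ofReal_one Q φ hα, valueIter_succ_one]
    gcongr
    rcases Q.mem_actions_one.1 (φ.2 (i, 1)) with h | h <;> rw [h]
    exacts [min_le_left _ _, min_le_right _ _]

/-- A policy that attains the minimum in the `(n + 1)`-st step of value iteration. -/
def IsGreedy (φ : Q.Policy) (α : ℝ) (n : ℕ) : Prop :=
  ∀ i, ∀ a ∈ Q.actions (i, 1),
    Q.actionCost α (Q.valueIter α n) i (φ.1 (i, 1)) ≤ Q.actionCost α (Q.valueIter α n) i a

theorem IsGreedy.evalOp_eq {Q : ControlledQueue} {φ : Q.Policy} {α : ℝ} {n : ℕ}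
    (h : Q.IsGreedy φ α n) (hα : α ≤ 1) (s : State) :
    Q.evalOp φ α (fun t => ENNReal.ofReal (Q.valueIter α n t)) s
      = ENNReal.ofReal (Q.valueIter α (n + 1) s) := by
  refine le_antisymm ?_ (Q.ofReal_valueIter_succ_le φ hα n s)
  obtain ⟨i, q⟩ := s
  fin_cases q
  · exact (Q.evalOp_ofReal_zero φ hα n i).le
  · change Q.evalOp φ α (fun t => ENNReal.ofReal (Q.valueIter α n t)) (i, 1)
      ≤ ENNReal.ofReal (Q.valueIter α (n + 1) (i, 1))
    rw [evalOp_ofReal_one Q φ hα, valueIter_succ_one]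
    gcongr
    exact le_min (h i _ (Q.mem_actions_one.2 (Or.inl rfl))) (h i _ (Q.mem_actions_one.2 (Or.inr rfl)))

theorem ofReal_valueIter_le_discountedCost (φ : Q.Policy) {α : ℝ} (hα : α ≤ 1) (n : ℕ)
    (s : State) : ENNReal.ofReal (Q.valueIter α n s) ≤ Q.discountedCost φ α s := by
  rw [Q.iSup_evalOp_iterate φ hα]
  refine le_trans ?_ (le_iSup _ n)
  induction n generalizing s with
  | zero => simp [valueIter]
  | succ n ih =>
    rw [Function.iterate_succ_apply']
    exact (Q.ofReal_valueIter_succ_le φ hα n s).trans (Q.evalOp_mono φ α (fun t => ih t) s)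

/-- A policy that is eventually greedy for value iteration is optimal. -/
theorem discountedCost_le_of_isGreedy {φ' : Q.Policy} {α : ℝ} (hα : α ≤ 1) {N : ℕ}
    (hg : ∀ n, N ≤ n → Q.IsGreedy φ' α n) (φ : Q.Policy) (s : State) :
    Q.discountedCost φ' α s ≤ Q.discountedCost φ α s := by
  rw [Q.iSup_evalOp_iterate φ' hα]
  -- Starting from `0 ≤ V_N` instead of `V_N`, `k` greedy steps cannot exceed `V_{N+k}`, which
  -- bounds the cost of every policy from below.
  refine iSup_le fun k => le_trans ?_ (Q.ofReal_valueIter_le_discountedCost φ hα (N + k) s)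
  induction k generalizing s with
  | zero => simp
  | succ k ih =>
    rw [Function.iterate_succ_apply', ← add_assoc,
      ← (hg (N + k) (Nat.le_add_right N k)).evalOp_eq hα]
    exact Q.evalOp_mono φ' α (fun t => ih t) s

/-! ### Increments of the value iterates -/

/-- Increment of the `n`-th value iterate in the number of customers. -/
noncomputable def increment (α : ℝ) (n : ℕ) (q : Fin 2) (i : ℕ) : ℝ :=
  Q.valueIter α n (i, q) - Q.valueIter α n (i - 1, q)

/-- The map that yields the new increment without control. -/
noncomputable def freeStep (γ g e₀ e₁ e₂ : ℝ) : ℝ :=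
  g + γ * (Q.mu * e₀ + (1 - Q.mu - Q.lam) * e₁ + Q.lam * e₂)

/-- The map that yields the new increment under control. -/
noncomputable def controlStep (γ g e d₀ d₁ d₂ : ℝ) : ℝ :=
  g + γ * (Q.beta * e + Q.mu1 * d₁ + Q.mu1 * d₀ + Q.lam * d₂)
    + min (γ * ((Q.mu2 - Q.mu1) * d₁)) Q.c2 + max 0 (γ * ((Q.mu2 - Q.mu1) * d₀) - Q.c2)

theorem increment_zero_left (α : ℝ) (q : Fin 2) (i : ℕ) : Q.increment α 0 q i = 0 := sub_self 0

theorem increment_zero_right (α : ℝ) (n : ℕ) (q : Fin 2) : Q.increment α n q 0 = 0 := sub_self _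

theorem actionCost_mu1 (α : ℝ) (n i : ℕ) :
    Q.actionCost α (Q.valueIter α n) i Q.mu1
      = (1 - α) * ((Q.mu2 - Q.mu1) * Q.valueIter α n (i, 1)) := by
  rw [actionCost, rateCost_mu1]
  ring

theorem actionCost_mu2 (α : ℝ) (n i : ℕ) :
    Q.actionCost α (Q.valueIter α n) i Q.mu2
      = Q.c2 + (1 - α) * ((Q.mu2 - Q.mu1) * Q.valueIter α n (i - 1, 1)) := by
  rw [actionCost, rateCost_mu2]
  ring

/-- Used at `i + 1`, while the next form is used at `i`: both then split off the same multiple of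
the value at `i`, which cancels and leaves a sum of two terms that are monotone in the increments.
-/
theorem min_actionCost_eq_add_min (α : ℝ) (n i : ℕ) :
    min (Q.actionCost α (Q.valueIter α n) i Q.mu1) (Q.actionCost α (Q.valueIter α n) i Q.mu2)
      = (1 - α) * ((Q.mu2 - Q.mu1) * Q.valueIter α n (i - 1, 1))
        + min ((1 - α) * ((Q.mu2 - Q.mu1) * Q.increment α n 1 i)) Q.c2 := by
  rw [actionCost_mu1, actionCost_mu2, ← min_add_add_left, increment]
  congr 1 <;> ring

theorem min_actionCost_eq_sub_max (α : ℝ) (n i : ℕ) :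
    min (Q.actionCost α (Q.valueIter α n) i Q.mu1) (Q.actionCost α (Q.valueIter α n) i Q.mu2)
      = (1 - α) * ((Q.mu2 - Q.mu1) * Q.valueIter α n (i, 1))
        - max 0 ((1 - α) * ((Q.mu2 - Q.mu1) * Q.increment α n 1 i) - Q.c2) := by
  rw [actionCost_mu1, actionCost_mu2, ← min_sub_sub_left, increment]
  congr 1 <;> ring

theorem increment_succ_zero (α : ℝ) (n i : ℕ) :
    Q.increment α (n + 1) 0 (i + 1) = Q.freeStep (1 - α) (Q.h (i + 1) - Q.h i)
      (Q.increment α n 0 i) (Q.increment α n 0 (i + 1)) (Q.increment α n 0 (i + 2)) := by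
  simp only [increment, Nat.add_sub_cancel, valueIter_succ_zero, freeStep,
    show i + 2 - 1 = i + 1 from rfl]
  ring

theorem increment_succ_one (α : ℝ) (n i : ℕ) :
    Q.increment α (n + 1) 1 (i + 1) = Q.controlStep (1 - α) (Q.h (i + 1) - Q.h i)
      (Q.increment α n 0 (i + 1)) (Q.increment α n 1 i) (Q.increment α n 1 (i + 1))
      (Q.increment α n 1 (i + 2)) := by
  rw [increment, Nat.add_sub_cancel, valueIter_succ_one, valueIter_succ_one,
    min_actionCost_eq_add_min, min_actionCost_eq_sub_max, controlStep]
  simp only [increment, Nat.add_sub_cancel, show i + 2 - 1 = i + 1 from rfl]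
  ring

theorem freeStep_mono {γ γ' g g' e₀ e₀' e₁ e₁' e₂ e₂' : ℝ} (hγ : 0 ≤ γ) (hγ' : γ ≤ γ')
    (hg : g ≤ g') (h₀ : 0 ≤ e₀) (h₀' : e₀ ≤ e₀') (h₁ : 0 ≤ e₁) (h₁' : e₁ ≤ e₁')
    (h₂ : 0 ≤ e₂) (h₂' : e₂ ≤ e₂') :
    Q.freeStep γ g e₀ e₁ e₂ ≤ Q.freeStep γ' g' e₀' e₁' e₂' := by
  have := Q.mu_pos
  have := Q.lam_pos
  have : 0 ≤ 1 - Q.mu - Q.lam := by linarith [Q.mu_add_lam_le]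
  have : 0 ≤ γ' := hγ.trans hγ'
  unfold freeStep
  gcongr

/-- Monotonicity with a quantitative gain: an increase of the last argument passes through the
arrival term with factor `γ * lam`. This carries strict growth along. -/
theorem controlStep_add_le {γ γ' g g' e e' d₀ d₀' d₁ d₁' d₂ d₂' : ℝ} (hγ : 0 ≤ γ) (hγ' : γ ≤ γ')
    (hg : g ≤ g') (h : 0 ≤ e) (h' : e ≤ e') (h₀ : 0 ≤ d₀) (h₀' : d₀ ≤ d₀') (h₁ : 0 ≤ d₁)
    (h₁' : d₁ ≤ d₁') (h₂ : 0 ≤ d₂) (h₂' : d₂ ≤ d₂') :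
    Q.controlStep γ g e d₀ d₁ d₂ + γ * Q.lam * (d₂' - d₂)
      ≤ Q.controlStep γ' g' e' d₀' d₁' d₂' := by
  have := Q.mu1_pos
  have := Q.lam_pos
  have := Q.beta_pos
  have : 0 ≤ Q.mu2 - Q.mu1 := sub_nonneg.2 Q.mu1_lt_mu2.le
  have : 0 ≤ γ' := hγ.trans hγ'
  have h₂'' : 0 ≤ d₂' := h₂.trans h₂'
  calc Q.controlStep γ g e d₀ d₁ d₂ + γ * Q.lam * (d₂' - d₂)
      = Q.controlStep γ g e d₀ d₁ d₂' := by unfold controlStep; ring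
    _ ≤ _ := by unfold controlStep; gcongr

theorem controlStep_mono {γ γ' g g' e e' d₀ d₀' d₁ d₁' d₂ d₂' : ℝ} (hγ : 0 ≤ γ) (hγ' : γ ≤ γ')
    (hg : g ≤ g') (h : 0 ≤ e) (h' : e ≤ e') (h₀ : 0 ≤ d₀) (h₀' : d₀ ≤ d₀') (h₁ : 0 ≤ d₁)
    (h₁' : d₁ ≤ d₁') (h₂ : 0 ≤ d₂) (h₂' : d₂ ≤ d₂') :
    Q.controlStep γ g e d₀ d₁ d₂ ≤ Q.controlStep γ' g' e' d₀' d₁' d₂' :=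
  le_trans (le_add_of_nonneg_right
      (mul_nonneg (mul_nonneg hγ Q.lam_pos.le) (sub_nonneg.2 h₂')))
    (Q.controlStep_add_le hγ hγ' hg h h' h₀ h₀' h₁ h₁' h₂ h₂')

theorem controlStep_zero (γ : ℝ) : Q.controlStep γ 0 0 0 0 0 = 0 := by
  simp [controlStep, Q.c2_pos.le]

/-! ### Sign and monotonicity of the increments -/

theorem increment_nonneg {α : ℝ} (hα : α ≤ 1) (n : ℕ) (q : Fin 2) (i : ℕ) :
    0 ≤ Q.increment α n q i := by
  induction n generalizing q i with
  | zero => exact (Q.increment_zero_left α q i).ge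
  | succ n ih =>
    rcases i with _ | i
    · exact (Q.increment_zero_right α _ q).ge
    have h0 := sub_nonneg.2 hα
    have hh : 0 ≤ Q.h (i + 1) - Q.h i := sub_nonneg.2 (Q.h_mono (Nat.le_succ i))
    fin_cases q
    · change 0 ≤ Q.increment α (n + 1) 0 (i + 1)
      rw [increment_succ_zero]
      refine le_trans (by simp [freeStep]) (Q.freeStep_mono h0 le_rfl hh le_rfl (ih 0 i) le_rfl
        (ih 0 (i + 1)) le_rfl (ih 0 (i + 2)))
    · change 0 ≤ Q.increment α (n + 1) 1 (i + 1)
      rw [increment_succ_one]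
      exact (Q.controlStep_zero (1 - α)).ge.trans (Q.controlStep_mono h0 le_rfl hh le_rfl
        (ih 0 (i + 1)) le_rfl (ih 1 i) le_rfl (ih 1 (i + 1)) le_rfl (ih 1 (i + 2)))

/-- Convexity of `h` propagates through the monotone recursion; at the boundary it reduces to
nonnegativity, as the increment at `0` vanishes. -/
theorem increment_mono_customers {α : ℝ} (hα : α ≤ 1) (n : ℕ) (q : Fin 2) :
    Monotone (Q.increment α n q) := by
  have hn := Q.increment_nonneg hα
  have h0 := sub_nonneg.2 hα
  induction n generalizing q with
  | zero => exact fun i j _ => by simp only [increment_zero_left, le_refl]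
  | succ n ih =>
    have hs : ∀ q i, Q.increment α n q i ≤ Q.increment α n q (i + 1) := fun q i =>
      ih q (Nat.le_succ i)
    refine monotone_nat_of_le_succ fun i => ?_
    rcases i with _ | i
    · exact (Q.increment_zero_right α _ q).trans_le (hn _ _ _)
    fin_cases q
    · change Q.increment α (n + 1) 0 (i + 1) ≤ Q.increment α (n + 1) 0 (i + 1 + 1)
      rw [increment_succ_zero, increment_succ_zero]
      exact Q.freeStep_mono h0 le_rfl (Q.h_convex i) (hn _ _ _) (hs _ _) (hn _ _ _) (hs _ _)
        (hn _ _ _) (hs _ _)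
    · change Q.increment α (n + 1) 1 (i + 1) ≤ Q.increment α (n + 1) 1 (i + 1 + 1)
      rw [increment_succ_one, increment_succ_one]
      exact Q.controlStep_mono h0 le_rfl (Q.h_convex i) (hn _ _ _) (hs _ _) (hn _ _ _) (hs _ _)
        (hn _ _ _) (hs _ _) (hn _ _ _) (hs _ _)

theorem increment_le_succ {α : ℝ} (hα : α ≤ 1) (n : ℕ) (q : Fin 2) (i : ℕ) :
    Q.increment α n q i ≤ Q.increment α (n + 1) q i := by
  have hn := Q.increment_nonneg hα
  have h0 := sub_nonneg.2 hα
  induction n generalizing q i with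
  | zero => exact (Q.increment_zero_left α q i).trans_le (hn _ _ _)
  | succ n ih =>
    rcases i with _ | i
    · exact (Q.increment_zero_right α _ q).trans_le (hn _ _ _)
    fin_cases q
    · change Q.increment α (n + 1) 0 (i + 1) ≤ Q.increment α (n + 1 + 1) 0 (i + 1)
      rw [increment_succ_zero, increment_succ_zero]
      exact Q.freeStep_mono h0 le_rfl le_rfl (hn _ _ _) (ih _ _) (hn _ _ _) (ih _ _)
        (hn _ _ _) (ih _ _)
    · change Q.increment α (n + 1) 1 (i + 1) ≤ Q.increment α (n + 1 + 1) 1 (i + 1)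
      rw [increment_succ_one, increment_succ_one]
      exact Q.controlStep_mono h0 le_rfl le_rfl (hn _ _ _) (ih _ _) (hn _ _ _) (ih _ _)
        (hn _ _ _) (ih _ _) (hn _ _ _) (ih _ _)

theorem increment_mono_iter {α : ℝ} (hα : α ≤ 1) (q : Fin 2) (i : ℕ) :
    Monotone (fun n => Q.increment α n q i) :=
  monotone_nat_of_le_succ fun n => Q.increment_le_succ hα n q i

theorem increment_anti_discount {α α' : ℝ} (h : α ≤ α') (hα' : α' ≤ 1) (n : ℕ) (q : Fin 2)
    (i : ℕ) : Q.increment α' n q i ≤ Q.increment α n q i := by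
  have hn := Q.increment_nonneg hα'
  have h0 := sub_nonneg.2 hα'
  have h1 : 1 - α' ≤ 1 - α := sub_le_sub_left h 1
  induction n generalizing q i with
  | zero => simp only [increment_zero_left, le_refl]
  | succ n ih =>
    rcases i with _ | i
    · simp only [increment_zero_right, le_refl]
    fin_cases q
    · change Q.increment α' (n + 1) 0 (i + 1) ≤ Q.increment α (n + 1) 0 (i + 1)
      rw [increment_succ_zero, increment_succ_zero]
      exact Q.freeStep_mono h0 h1 le_rfl (hn _ _ _) (ih _ _) (hn _ _ _) (ih _ _)
        (hn _ _ _) (ih _ _)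
    · change Q.increment α' (n + 1) 1 (i + 1) ≤ Q.increment α (n + 1) 1 (i + 1)
      rw [increment_succ_one, increment_succ_one]
      exact Q.controlStep_mono h0 h1 le_rfl (hn _ _ _) (ih _ _) (hn _ _ _) (ih _ _)
        (hn _ _ _) (ih _ _) (hn _ _ _) (ih _ _)

/-! ### Strict growth in the iteration, continuity in the discount -/

theorem exists_h_lt_succ : ∃ j, Q.h j < Q.h (j + 1) := by
  by_contra! hcon
  have hle : ∀ j, Q.h j ≤ 0 := fun j => by
    induction j with
    | zero => exact Q.h_zero.le
    | succ j ih => exact (hcon j).trans ih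
  exact Q.h_unbounded ⟨0, by rintro _ ⟨j, rfl⟩; exact hle j⟩

theorem h_increment_mono : Monotone (fun i => Q.h (i + 1) - Q.h i) :=
  monotone_nat_of_le_succ Q.h_convex

/-- The increments under control are eventually strictly increasing in the iteration. -/
theorem increment_lt_succ {α : ℝ} (hα : α < 1) {j : ℕ} (hj : Q.h j < Q.h (j + 1)) {n i : ℕ}
    (hn : j ≤ n + i) : Q.increment α n 1 (i + 1) < Q.increment α (n + 1) 1 (i + 1) := by
  have hnn := Q.increment_nonneg hα.le
  have h0 : 0 < 1 - α := sub_pos.2 hα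
  induction n generalizing i with
  | zero =>
    rw [increment_succ_one]
    simp only [increment_zero_left]
    -- The first iterate has increment `h (i + 1) - h i`, positive from `j` on by convexity.
    have h1 : Q.h (j + 1) - Q.h j ≤ Q.h (i + 1) - Q.h i := Q.h_increment_mono (by simpa using hn)
    have h2 := Q.c2_pos.le
    simp only [controlStep, mul_zero, add_zero, min_eq_left h2, zero_sub, max_eq_left (neg_nonpos.2 h2)]
    linarith
  | succ n ih =>
    -- Strict growth one customer higher reaches this state through an arrival; `n + i` is unchanged
    -- by the shift.
    have hlt := ih (i := i + 1) (by omega)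
    have hpos := mul_pos (mul_pos h0 Q.lam_pos) (sub_pos.2 hlt)
    have hs := Q.increment_le_succ hα.le n
    rw [Q.increment_succ_one α n, Q.increment_succ_one α (n + 1)]
    exact (lt_add_of_pos_right _ hpos).trans_le (Q.controlStep_add_le h0.le le_rfl le_rfl
      (hnn _ _ _) (hs _ _) (hnn _ _ _) (hs _ _) (hnn _ _ _) (hs _ _) (hnn _ _ _) (hs _ _))

theorem exists_increment_lt {α : ℝ} (hα : α < 1) (n i : ℕ) :
    ∃ m, Q.increment α n 1 (i + 1) < Q.increment α m 1 (i + 1) := by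
  obtain ⟨j, hj⟩ := Q.exists_h_lt_succ
  exact ⟨max n j + 1, (Q.increment_mono_iter hα.le 1 (i + 1) (le_max_left n j)).trans_lt
    (Q.increment_lt_succ hα hj ((le_max_right n j).trans (Nat.le_add_right _ _)))⟩

theorem continuous_valueIter (n : ℕ) (s : State) : Continuous fun α => Q.valueIter α n s := by
  induction n generalizing s with
  | zero => exact continuous_const
  | succ n ih =>
    obtain ⟨i, q⟩ := s
    fin_cases q
    · change Continuous fun α => Q.valueIter α (n + 1) (i, 0)
      simp only [valueIter_succ_zero]
      fun_prop
    · change Continuous fun α => Q.valueIter α (n + 1) (i, 1)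
      simp only [valueIter_succ_one, actionCost]
      fun_prop

/-! ### Greedy and limiting policies -/

theorem actionCost_mu1_le_iff (α : ℝ) (n i : ℕ) :
    Q.actionCost α (Q.valueIter α n) i Q.mu1 ≤ Q.actionCost α (Q.valueIter α n) i Q.mu2
      ↔ (1 - α) * ((Q.mu2 - Q.mu1) * Q.increment α n 1 i) ≤ Q.c2 := by
  rw [actionCost_mu1, actionCost_mu2, increment, mul_sub (Q.mu2 - Q.mu1), mul_sub (1 - α),
    sub_le_iff_le_add]

theorem isGreedy_of_threshold {φ : Q.Policy} {α : ℝ} {n : ℕ}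
    (h1 : ∀ i, φ.1 (i, 1) = Q.mu1 → (1 - α) * ((Q.mu2 - Q.mu1) * Q.increment α n 1 i) ≤ Q.c2)
    (h2 : ∀ i, φ.1 (i, 1) = Q.mu2 → Q.c2 ≤ (1 - α) * ((Q.mu2 - Q.mu1) * Q.increment α n 1 i)) :
    Q.IsGreedy φ α n := by
  have h3 : ∀ i, φ.1 (i, 1) = Q.mu2 →
      Q.actionCost α (Q.valueIter α n) i Q.mu2 ≤ Q.actionCost α (Q.valueIter α n) i Q.mu1 := by
    intro i hi
    have := h2 i hi
    rw [increment] at this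
    rw [actionCost_mu1, actionCost_mu2]
    linarith
  intro i a ha
  rcases Q.mem_actions_one.1 (φ.2 (i, 1)) with h | h <;>
    rcases Q.mem_actions_one.1 ha with rfl | rfl <;> rw [h]
  exacts [(Q.actionCost_mu1_le_iff α n i).2 (h1 i h), h3 i h]

/-- Every action of a limiting policy is chosen infinitely often. -/
theorem frequently_apply_eq {φ : ℕ → Q.Policy} {φ' : Q.Policy} (h : MapClusterPt φ' atTop φ)
    (i : ℕ) : ∃ᶠ n in atTop, (φ n).1 (i, 1) = φ'.1 (i, 1) := by
  have hd : 0 < Q.mu2 - Q.mu1 := sub_pos.2 Q.mu1_lt_mu2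
  have hc : Continuous fun ψ : Q.Policy => ψ.1 (i, 1) :=
    (continuous_apply (i, 1)).comp continuous_subtype_val
  -- Two distinct actions are at distance `mu2 - mu1`, so a ball of this radius isolates the action.
  have hU := hc.continuousAt.preimage_mem_nhds (Metric.ball_mem_nhds (φ'.1 (i, 1)) hd)
  refine (mapClusterPt_iff_frequently.1 h _ hU).mono fun n hn => ?_
  have hn' : |(φ n).1 (i, 1) - φ'.1 (i, 1)| < Q.mu2 - Q.mu1 := hn
  rw [abs_lt] at hn'
  rcases Q.mem_actions_one.1 ((φ n).2 (i, 1)) with h1 | h1 <;>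
    rcases Q.mem_actions_one.1 (φ'.2 (i, 1)) with h2 | h2 <;> rw [h1, h2] at hn' ⊢ <;>
    linarith [hn'.1, hn'.2]

/-- A limiting policy uses the high rate exactly where some value iterate calls for it. -/
theorem IsLimitingPolicy.apply_eq_mu2_iff {Q : ControlledQueue} {φ' : Q.Policy}
    (h : Q.IsLimitingPolicy φ') (i : ℕ) :
    φ'.1 (i, 1) = Q.mu2 ↔ ∃ n, Q.c2 < (Q.mu2 - Q.mu1) * Q.increment 0 n 1 i := by
  obtain ⟨φ, hφ, hcl⟩ := h
  have hd : 0 < Q.mu2 - Q.mu1 := sub_pos.2 Q.mu1_lt_mu2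
  have hf := Q.frequently_apply_eq hcl i
  constructor
  · intro h2
    obtain ⟨m, hm, hφm⟩ := (frequently_atTop.1 hf) 1
    obtain ⟨n, rfl⟩ : ∃ n, m = n + 1 := ⟨m - 1, by omega⟩
    have hle := hφ n i Q.mu1 (Q.mem_actions_one.2 (Or.inl rfl))
    rw [hφm, h2, actionCost_mu1, actionCost_mu2] at hle
    have hge : Q.c2 ≤ (Q.mu2 - Q.mu1) * Q.increment 0 n 1 i := by
      rw [increment]
      linarith
    -- The high rate is never greedy in the empty system. Elsewhere a possible tie becomes strict at
    -- a later iteration.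
    rcases i with _ | i
    · rw [increment_zero_right, mul_zero] at hge
      exact absurd Q.c2_pos hge.not_gt
    · obtain ⟨k, hk⟩ := Q.exists_increment_lt zero_lt_one n i
      exact ⟨k, hge.trans_lt (mul_lt_mul_of_pos_left hk hd)⟩
  · rintro ⟨n, hn⟩
    -- Taking `m` beyond `n` makes the iterate behind the choice at least the `n`-th, where the
    -- threshold is already exceeded.
    obtain ⟨m, hm, hφm⟩ := (frequently_atTop.1 hf) (n + 1)
    obtain ⟨k, rfl⟩ : ∃ k, m = k + 1 := ⟨m - 1, by omega⟩
    refine (Q.mem_actions_one.1 (φ'.2 (i, 1))).resolve_left fun h1 => ?_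
    have hle := hφ k i Q.mu2 (Q.mem_actions_one.2 (Or.inr rfl))
    rw [hφm, h1, actionCost_mu1_le_iff, sub_zero, one_mul] at hle
    exact (hn.trans_le (mul_le_mul_of_nonneg_left
      (Q.increment_mono_iter zero_le_one 1 i (by omega : n ≤ k)) hd.le)).not_ge hle

theorem IsLimitingPolicy.exists_isGreedy {Q : ControlledQueue} {φ' : Q.Policy}
    (h : Q.IsLimitingPolicy φ') : ∃ α' : ℝ, 0 < α' ∧ ∀ α : ℝ, 0 < α → α < α' →
      α ≤ 1 ∧ ∃ N, ∀ n, N ≤ n → Q.IsGreedy φ' α n := by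
  have hd : 0 < Q.mu2 - Q.mu1 := sub_pos.2 Q.mu1_lt_mu2
  have low : ∀ α : ℝ, 0 < α → α ≤ 1 → ∀ n i, φ'.1 (i, 1) = Q.mu1 →
      (1 - α) * ((Q.mu2 - Q.mu1) * Q.increment α n 1 i) ≤ Q.c2 := by
    intro α h0 h1 n i hi
    have hnot := mt (h.apply_eq_mu2_iff i).2 (by rw [hi]; exact Q.mu1_lt_mu2.ne)
    push Not at hnot
    calc (1 - α) * ((Q.mu2 - Q.mu1) * Q.increment α n 1 i)
        ≤ 1 * ((Q.mu2 - Q.mu1) * Q.increment α n 1 i) := by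
          have := mul_nonneg hd.le (Q.increment_nonneg h1 n 1 i)
          gcongr
          linarith
      _ = (Q.mu2 - Q.mu1) * Q.increment α n 1 i := one_mul _
      _ ≤ (Q.mu2 - Q.mu1) * Q.increment 0 n 1 i := by
          gcongr
          exact Q.increment_anti_discount h0.le h1 n 1 i
      _ ≤ Q.c2 := hnot n
  -- Only the smallest high-rate state constrains the discount; with no such state every discount
  -- below one works, from `N = 0` on.
  by_cases hex : ∃ i, φ'.1 (i, 1) = Q.mu2
  · classical
    obtain ⟨N, hN⟩ := (h.apply_eq_mu2_iff _).1 (Nat.find_spec hex)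
    set j := Nat.find hex with hj
    have hcont : Continuous fun α => (1 - α) * ((Q.mu2 - Q.mu1) * Q.increment α N 1 j) := by
      have := Q.continuous_valueIter N
      unfold increment
      fun_prop
    have hev : ∀ᶠ α in 𝓝 (0 : ℝ), Q.c2 < (1 - α) * ((Q.mu2 - Q.mu1) * Q.increment α N 1 j) :=
      hcont.continuousAt.eventually (lt_mem_nhds (by simpa using hN))
    obtain ⟨ε, hε, hball⟩ := Metric.eventually_nhds_iff.1 hev
    refine ⟨min ε 1, lt_min hε one_pos, fun α h0 hα => ?_⟩
    have h1 : α ≤ 1 := hα.le.trans (min_le_right _ _)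
    refine ⟨h1, N, fun n hn => Q.isGreedy_of_threshold (low α h0 h1 n) fun i hi => ?_⟩
    have hlt := hball (y := α) (by
      rw [Real.dist_eq, sub_zero, abs_of_pos h0]
      exact hα.trans_le (min_le_left _ _))
    have h2 := sub_nonneg.2 h1
    have hji : j ≤ i := Nat.find_min' hex hi
    refine hlt.le.trans ?_
    gcongr
    exact (Q.increment_mono_iter h1 1 j hn).trans (Q.increment_mono_customers h1 n 1 hji)
  · push Not at hex
    exact ⟨1, one_pos, fun α h0 hα => ⟨hα.le, 0, fun n _ =>
      Q.isGreedy_of_threshold (low α h0 hα.le n) fun i hi => absurd hi (hex i)⟩⟩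

end ControlledQueue

theorem mainTheorem4 (Q : ControlledQueue) (φ' : Q.Policy) (hφ' : Q.IsLimitingPolicy φ') :
    Q.StronglyBlackwellOptimal φ' := by
  obtain ⟨α', hα', hg⟩ := hφ'.exists_isGreedy
  refine ⟨α', hα', fun α h0 hα φ s => ?_⟩
  obtain ⟨h1, N, hN⟩ := hg α h0 hα
  exact Q.discountedCost_le_of_isGreedy h1 hN φ s
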